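/- Let $B$ range over separable real Banach spaces. A $B$-valued random variable $X$ on a probability space is in $L^2_0$ if $E\|X\|^2<\infty$ and $EX=0$. $B$ is type 2 with constant $c\in(0,\infty)$ if $E\|\sum_{i=1}^n X_i\|^2\le c\sum_{i=1}^n E\|X_i\|^2$ for every $n\ge 1$ and all independent $X_1,\dots,X_n\in L^2_0$ (on any probability space); $B$ is cotype 2 with constant $c\in(0,\infty)$ if the reversed inequality $E\|\sum_{i=1}^n X_i\|^2\ge c\sum_{i=1}^n E\|X_i\|^2$ always holds. $B$ is type 2 (cotype 2) if this is so for some constant $c\in(0,\infty)$. For $X\in L^2_0$ let $S_n=X_1+\dots+X_n$, where $X_1,X_2,\dots$ are independent random variables, each distributed as $X$. **Proposition.** (a) $B$ is type 2 if and only if there is a constant $c\in(0,\infty)$ such that for all $X\in L^2_0$ $$\limsup_{n\to\infty}\frac{E\|S_n\|^2}{n}\le c\,E\|X\|^2. \tag{1}$$ (b) $B$ is cotype 2 if and only if there is a constant $c\in(0,\infty)$ such that for all $X\in L^2_0$ $$\liminf_{n\to\infty}\frac{E\|S_n\|^2}{n}\ge c\,E\|X\|^2. \tag{2}$$ In both cases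 the constants may be chosen to depend only on each other, and not on $B$: for every $c\in(0,\infty)$ there is $c'\in(0,\infty)$ such that every $B$ satisfying (1) with constant $c$ is type 2 with constant $c'$, and every $B$ that is type 2 with constant $c$ satisfies (1) with constant $c'$; likewise, for every $c\in(0,\infty)$ there is $c'\in(0,\infty)$ such that every $B$ satisfying (2) with constant $c$ is cotype 2 with constant $c'$, and every $B$ that is cotype 2 with constant $c$ satisfies (2) with constant $c'$. -/

import Mathlib

open MeasureTheory ProbabilityTheory Filter
open scoped NNReal ENNReal

universe u v

namespace BanachType

/-- The second moment `E ‖X‖²`, as an extended nonnegative real. -/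
noncomputable def secondMoment {Ω : Type v} [MeasurableSpace Ω] {B : Type u}
    [NormedAddCommGroup B] (P : Measure Ω) (X : Ω → B) : ℝ≥0∞ :=
  ∫⁻ ω, ‖X ω‖ₑ ^ 2 ∂P

/-- `X ∈ L²₀`: `X` is a `B`-valued random variable with `E ‖X‖² < ∞` and `E X = 0`. -/
structure MemL2Zero {Ω : Type v} [MeasurableSpace Ω] {B : Type u} [NormedAddCommGroup B]
    [NormedSpace ℝ B] [MeasurableSpace B] (P : Measure Ω) (X : Ω → B) : Prop where
  measurable : Measurable X
  memLp : MemLp X 2 P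
  mean_zero : ∫ ω, X ω ∂P = 0

/-- `X 0, X 1, X 2, …` is a sequence of independent identically distributed `B`-valued random
variables, whose common distribution is in `L²₀`. -/
structure IsIIDL2Zero {Ω : Type v} [MeasurableSpace Ω] {B : Type u} [NormedAddCommGroup B]
    [NormedSpace ℝ B] [MeasurableSpace B] (P : Measure Ω) (X : ℕ → Ω → B) : Prop where
  indep : iIndepFun X P
  identDistrib : ∀ i, IdentDistrib (X i) (X 0) P P
  memL2Zero : ∀ i, MemL2Zero P (X i)

/-- The partial sum of the first `n` terms of the sequence `X`. -/
def partialSum {Ω : Type v} {B : Type u} [NormedAddCommGroup B]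
    (X : ℕ → Ω → B) (n : ℕ) (ω : Ω) : B :=
  ∑ i ∈ Finset.range n, X i ω

section Space

variable (B : Type u) [NormedAddCommGroup B] [NormedSpace ℝ B] [MeasurableSpace B]

/-- `c` satisfies the type 2 inequality of `B`: `E ‖∑ Xᵢ‖² ≤ c ∑ E ‖Xᵢ‖²` for all finite families
of independent random variables in `L²₀`, on all probability spaces. -/
def TypeTwoWith (c : ℝ≥0) : Prop :=
  ∀ (Ω : Type v) [MeasurableSpace Ω] (P : Measure Ω) [IsProbabilityMeasure P]
    (n : ℕ) (X : Fin n → Ω → B), 1 ≤ n → iIndepFun X P → (∀ i, MemL2Zero P (X i)) →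
      secondMoment P (fun ω => ∑ i, X i ω) ≤ c * ∑ i, secondMoment P (X i)

/-- `c` satisfies the cotype 2 inequality of `B`: the type 2 inequality reversed. -/
def CotypeTwoWith (c : ℝ≥0) : Prop :=
  ∀ (Ω : Type v) [MeasurableSpace Ω] (P : Measure Ω) [IsProbabilityMeasure P]
    (n : ℕ) (X : Fin n → Ω → B), 1 ≤ n → iIndepFun X P → (∀ i, MemL2Zero P (X i)) →
      c * ∑ i, secondMoment P (X i) ≤ secondMoment P (fun ω => ∑ i, X i ω)

/-- `B` is type 2. -/
def IsTypeTwo : Prop := ∃ c : ℝ≥0, 0 < c ∧ TypeTwoWith.{u, v} B c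

/-- `B` is cotype 2. -/
def IsCotypeTwo : Prop := ∃ c : ℝ≥0, 0 < c ∧ CotypeTwoWith.{u, v} B c

/-- `limsup E ‖Sₙ‖² / n ≤ c E ‖X‖²` for all `X ∈ L²₀`, where `Sₙ` is the sum of `n` independent
copies of `X`. The upper limit is taken in `[0, ∞]`. -/
def LimsupWith (c : ℝ≥0) : Prop :=
  ∀ (Ω : Type v) [MeasurableSpace Ω] (P : Measure Ω) [IsProbabilityMeasure P]
    (X : ℕ → Ω → B), IsIIDL2Zero P X →
      limsup (fun n : ℕ => secondMoment P (partialSum X n) / (n : ℝ≥0∞)) atTop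
        ≤ c * secondMoment P (X 0)

/-- `liminf E ‖Sₙ‖² / n ≥ c E ‖X‖²` for all `X ∈ L²₀`, where `Sₙ` is the sum of `n` independent
copies of `X`. The lower limit is taken in `[0, ∞]`. -/
def LiminfWith (c : ℝ≥0) : Prop :=
  ∀ (Ω : Type v) [MeasurableSpace Ω] (P : Measure Ω) [IsProbabilityMeasure P]
    (X : ℕ → Ω → B), IsIIDL2Zero P X →
      c * secondMoment P (X 0)
        ≤ liminf (fun n : ℕ => secondMoment P (partialSum X n) / (n : ℝ≥0∞)) atTop

end Space

end BanachType

set_option linter.unusedSectionVars false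

/-! One direction is the defining inequality applied to independent copies of `X`. For the other,
take vectors y_1, …, y_k and let X = ∑ a_i y_i with independent symmetric a_i in {-1, 0, 1} of
variance p ≤ 1/(2k). Mostly at most one a_i is nonzero, so E‖X‖² lies between 1/2 and 3/2 times p ∑
‖y_i‖². Regrouping S_m by the vectors gives √(mp) ∑ h_i y_i, where the h_i are independent copies of
a normalized random walk. For large m the hypothesis thus becomes a type or cotype inequality with
coefficients h_i (`WeakTypeTwoWith`, `WeakCotypeTwoWith`), where h is standardized with fourth and
sixth moments at most 4 and 31. By symmetrization it remains to compare ∑ h_i x_i with the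
Rademacher average R(x).

For type 2, E|h| ≥ 1/2, and Jensen with the contraction principle gives R(x) ≤ 4 E‖∑ h_i x_i‖².

Cotype 2 needs E‖∑ h_i x_i‖² ≤ C R(x), which moment bounds do not give in a general space; the
hypothesis itself must be used again. Applied to the sums over k disjoint blocks of indices, it
bounds c ∑_j R(x on block j) by E(max_j h_j²) R(x), which is O(k^(1/3)) R(x) by the sixth moment.
Hence a random set of indices of density at most 1/k carries on average O(k^(-2/3)) R(x). Split h
into dyadic levels |h| ≤ 2^(l+2) of probability at most 64^(-l): with k = 64^l, level l costs
16^(-l), against 4^l from h² and 2^l from splitting the sum, and the series converges. -/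

namespace BanachType

open Finset
open scoped BigOperators

/-! ### Rademacher averages and the contraction principle -/

section Rademacher

variable {ι : Type*} [Fintype ι] [DecidableEq ι] {B : Type*} [NormedAddCommGroup B]
  [NormedSpace ℝ B]

/-- The mean of `‖∑ εᵢ xᵢ‖²` over all choices of signs `εᵢ`. -/
noncomputable def rademacherAvg (x : ι → B) : ℝ :=
  𝔼 s : ι → ℤˣ, ‖∑ i, s i • x i‖ ^ 2

lemma rademacherAvg_nonneg (x : ι → B) : 0 ≤ rademacherAvg x :=
  expect_nonneg fun _ _ => by positivity

lemma rademacherAvg_sign (t : ι → ℤˣ) (x : ι → B) :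
    rademacherAvg (fun i => t i • x i) = rademacherAvg x :=
  Fintype.expect_equiv (Equiv.mulRight t) _ _ fun s => by simp [mul_smul]

lemma norm_add_sq_le (a b : B) : ‖a + b‖ ^ 2 ≤ 2 * ‖a‖ ^ 2 + 2 * ‖b‖ ^ 2 := by
  have h := norm_add_le a b
  nlinarith [norm_nonneg (a + b), norm_nonneg a, norm_nonneg b, sq_nonneg (‖a‖ - ‖b‖)]

lemma rademacherAvg_add_le (x y : ι → B) :
    rademacherAvg (x + y) ≤ 2 * rademacherAvg x + 2 * rademacherAvg y := by
  unfold rademacherAvg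
  rw [mul_expect, mul_expect, ← expect_add_distrib]
  refine expect_le_expect fun s _ => ?_
  simp only [Pi.add_apply, smul_add, sum_add_distrib]
  exact norm_add_sq_le _ _

lemma rademacherAvg_smul (r : ℝ) (x : ι → B) :
    rademacherAvg (fun i => r • x i) = r ^ 2 * rademacherAvg x := by
  unfold rademacherAvg
  rw [mul_expect]
  refine expect_congr rfl fun s _ => ?_
  simp_rw [smul_comm _ r, ← smul_sum, norm_smul, mul_pow, Real.norm_eq_abs, sq_abs]

/-- Peeling off one term at a time doubles the weight at each step. The growth is harmless because
the dyadic pieces of h decay faster. -/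
lemma rademacherAvg_sum_le (L : ℕ) (y : ℕ → ι → B) :
    rademacherAvg (fun i => ∑ l ∈ range L, y l i)
      ≤ ∑ l ∈ range L, 2 ^ (l + 1) * rademacherAvg (y l) := by
  induction L generalizing y with
  | zero => simp [rademacherAvg]
  | succ L ih =>
    have h1 : (fun i => ∑ l ∈ range (L + 1), y l i)
        = (fun i => ∑ l ∈ range L, y (l + 1) i) + y 0 := by
      ext i; simp [sum_range_succ']
    have h2 := ih (fun l => y (l + 1))
    rw [h1, sum_range_succ']
    refine (rademacherAvg_add_le _ _).trans ?_
    refine add_le_add ?_ (by simp)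
    refine (mul_le_mul_of_nonneg_left h2 zero_le_two).trans (le_of_eq ?_)
    rw [mul_sum]
    exact sum_congr rfl fun l _ => by ring

lemma convexOn_rademacherAvg (x : ι → B) :
    ConvexOn ℝ Set.univ fun a : ι → ℝ => rademacherAvg fun i => a i • x i := by
  refine ⟨convex_univ, fun a _ b _ p q hp hq hpq => ?_⟩
  simp only [rademacherAvg, smul_eq_mul]
  rw [mul_expect, mul_expect, ← expect_add_distrib]
  refine expect_le_expect fun s _ => ?_
  have h1 : ∑ i, s i • (p • a + q • b) i • x i
      = p • ∑ i, s i • a i • x i + q • ∑ i, s i • b i • x i := by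
    simp only [smul_sum, ← sum_add_distrib]
    refine sum_congr rfl fun i _ => ?_
    rw [smul_comm p, smul_comm q, ← smul_add]
    simp [add_smul, mul_smul]
  rw [h1]
  exact ((convexOn_univ_norm (E := B)).pow (fun _ _ => norm_nonneg _) 2).2 trivial trivial hp hq hpq

/-- A convex function on the cube is bounded at each point by its value at some vertex, and at a
vertex the coefficients are signs, which leave the average unchanged. -/
lemma rademacherAvg_smul_le_of_abs_le_one (x : ι → B) (a : ι → ℝ) (ha : ∀ i, |a i| ≤ 1) :
    rademacherAvg (fun i => a i • x i) ≤ rademacherAvg x := by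
  have hmem : a ∈ convexHull ℝ (Set.univ.pi fun _ : ι => ({-1, 1} : Set ℝ)) := by
    rw [convexHull_pi]
    intro i _
    rw [convexHull_pair, segment_eq_Icc (by norm_num)]
    exact abs_le.1 (ha i)
  obtain ⟨b, hb, hab⟩ := ((convexOn_rademacherAvg x).subset (Set.subset_univ _)
    (convex_convexHull ℝ _)).exists_ge_of_mem_convexHull (subset_convexHull ℝ _) hmem
  refine hab.trans (le_of_eq ?_)
  have hb' : ∀ i, ∃ t : ℤˣ, ∀ v : B, b i • v = t • v := by
    intro i
    rcases hb i trivial with h | h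
    · exact ⟨-1, fun v => by rw [h]; simp [Units.smul_def]⟩
    · exact ⟨1, fun v => by simp at h; rw [h]; simp⟩
  choose t ht using hb'
  simp only [ht]
  exact rademacherAvg_sign t x

/-- The contraction principle. -/
lemma rademacherAvg_contraction (x : ι → B) (a : ι → ℝ) {r : ℝ} (hr : 0 ≤ r)
    (ha : ∀ i, a i ^ 2 ≤ r) : rademacherAvg (fun i => a i • x i) ≤ r * rademacherAvg x := by
  rcases hr.eq_or_lt with rfl | hr
  · have h0 : ∀ i, a i = 0 := fun i => pow_eq_zero_iff two_ne_zero |>.1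
      (le_antisymm (ha i) (sq_nonneg _))
    simp [h0, rademacherAvg]
  · have hs : 0 < √r := Real.sqrt_pos.2 hr
    have h1 : (fun i => a i • x i) = fun i => √r • ((a i / √r) • x i) := by
      ext i; rw [smul_smul, mul_div_cancel₀ _ hs.ne']
    rw [h1, rademacherAvg_smul, Real.sq_sqrt hr.le]
    refine mul_le_mul_of_nonneg_left (rademacherAvg_smul_le_of_abs_le_one x _ fun i => ?_) hr.le
    rw [abs_div, abs_of_pos hs, div_le_one hs]
    exact Real.abs_le_sqrt (ha i)

/-- Applying `σ` in the coordinates with sign -1 permutes `ι → Q`, so every sign pattern gives the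
same mean. -/
lemma expect_norm_sq_eq_expect_rademacherAvg {Q : Type*} [Fintype Q] (h : Q → ℝ)
    (σ : Equiv.Perm Q) (hσ : ∀ q, h (σ q) = -h q) (x : ι → B) :
    𝔼 ω : ι → Q, ‖∑ i, h (ω i) • x i‖ ^ 2
      = 𝔼 ω : ι → Q, rademacherAvg fun i => h (ω i) • x i := by
  have key : ∀ s : ι → ℤˣ, 𝔼 ω : ι → Q, ‖∑ i, s i • h (ω i) • x i‖ ^ 2
      = 𝔼 ω : ι → Q, ‖∑ i, h (ω i) • x i‖ ^ 2 := by
    intro s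
    refine Fintype.expect_equiv
      (Equiv.piCongrRight fun i => if s i = 1 then Equiv.refl Q else σ) _ _ fun ω => ?_
    congr 2
    refine sum_congr rfl fun i _ => ?_
    rcases Int.units_eq_one_or (s i) with hs | hs
    · simp [hs]
    · simp [hs, hσ, Units.smul_def]
  unfold rademacherAvg
  rw [expect_comm, expect_congr rfl fun s _ => key s, expect_const univ_nonempty]

lemma norm_expect_sq_le {Q : Type*} [Fintype Q] [Nonempty Q] (v : Q → B) :
    ‖(Fintype.card Q : ℝ)⁻¹ • ∑ q, v q‖ ^ 2 ≤ 𝔼 q, ‖v q‖ ^ 2 := by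
  have hc : (0 : ℝ) < Fintype.card Q := by exact_mod_cast Fintype.card_pos
  rw [Fintype.expect_eq_sum_div_card, norm_smul, mul_pow, norm_inv, Real.norm_of_nonneg hc.le,
    le_div_iff₀ hc]
  have h1 : ‖∑ q, v q‖ ^ 2 ≤ Fintype.card Q * ∑ q, ‖v q‖ ^ 2 :=
    (pow_le_pow_left₀ (norm_nonneg _) (norm_sum_le _ _) 2).trans
      (by simpa using sq_sum_le_card_mul_sum_sq (s := univ) (f := fun q => ‖v q‖))
  calc _ = (Fintype.card Q : ℝ)⁻¹ * ‖∑ q, v q‖ ^ 2 := by field_simp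
    _ ≤ (Fintype.card Q : ℝ)⁻¹ * (Fintype.card Q * ∑ q, ‖v q‖ ^ 2) := by gcongr
    _ = _ := by field_simp

end Rademacher

/-! ### Standardized coefficients and the weak type and cotype inequalities -/

/-- A finite symmetric random variable, defined on the finite set `Q` with the uniform
distribution, with variance one and with bounded fourth and sixth moments. -/
structure IsSymmetricStandardized {Q : Type*} [Fintype Q] (h : Q → ℝ) : Prop where
  symm : ∃ σ : Equiv.Perm Q, ∀ q, h (σ q) = -h q
  moment_two : 𝔼 q, h q ^ 2 = 1
  moment_four : 𝔼 q, h q ^ 4 ≤ 4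
  moment_six : 𝔼 q, h q ^ 6 ≤ 31

/-- For finitely many finite families of vectors there is a standardized symmetric random variable
`h` such that the cotype 2 inequality with constant `c` holds for these families and for
coefficients that are independent copies of `h`. -/
def WeakCotypeTwoWith (B : Type u) [NormedAddCommGroup B] [NormedSpace ℝ B] (c : ℝ) : Prop :=
  ∀ (k : ℕ) (β : Type) [Finite β] (y : β → Fin k → B),
    ∃ (Q : Type v) (_ : Fintype Q) (_ : Nonempty Q) (h : Q → ℝ), IsSymmetricStandardized h ∧
      ∀ b, c * ∑ j, ‖y b j‖ ^ 2 ≤ 𝔼 ω : Fin k → Q, ‖∑ j, h (ω j) • y b j‖ ^ 2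

/-- For a finite family of vectors there is a standardized symmetric random variable
`h` such that the type 2 inequality with constant `c` holds for this family and for
coefficients that are independent copies of `h`. -/
def WeakTypeTwoWith (B : Type u) [NormedAddCommGroup B] [NormedSpace ℝ B] (c : ℝ) : Prop :=
  ∀ (k : ℕ) (y : Fin k → B),
    ∃ (Q : Type v) (_ : Fintype Q) (_ : Nonempty Q) (h : Q → ℝ), IsSymmetricStandardized h ∧
      𝔼 ω : Fin k → Q, ‖∑ j, h (ω j) • y j‖ ^ 2 ≤ c * ∑ j, ‖y j‖ ^ 2

lemma expect_pi_prod {ι Q : Type*} [Fintype ι] [DecidableEq ι] [Fintype Q] (F : ι → Q → ℝ) :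
    𝔼 ω : ι → Q, ∏ i, F i (ω i) = ∏ i, 𝔼 q, F i q := by
  simp_rw [Fintype.expect_eq_sum_div_card, prod_div_distrib, Fintype.prod_sum]
  simp

lemma expect_pi_apply {ι Q : Type*} [Fintype ι] [DecidableEq ι] [Fintype Q] [Nonempty Q]
    (i : ι) (f : Q → ℝ) : 𝔼 ω : ι → Q, f (ω i) = 𝔼 q, f q := by
  have h := expect_pi_prod (ι := ι) (Q := Q) fun j q => if j = i then f q else 1
  have h2 : ∀ j, 𝔼 q : Q, (if j = i then f q else 1) = if j = i then 𝔼 q, f q else 1 :=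
    fun j => by split_ifs <;> simp [expect_const univ_nonempty]
  simpa [h2] using h

lemma expect_pi_apply_mul_apply {ι Q : Type*} [Fintype ι] [DecidableEq ι] [Fintype Q] [Nonempty Q]
    {i j : ι} (hij : i ≠ j) (f g : Q → ℝ) :
    𝔼 ω : ι → Q, f (ω i) * g (ω j) = (𝔼 q, f q) * 𝔼 q, g q := by
  have h := expect_pi_prod (ι := ι) (Q := Q) fun l q =>
    (if l = i then f q else 1) * if l = j then g q else 1
  have h2 : ∀ l, 𝔼 q : Q, ((if l = i then f q else 1) * if l = j then g q else 1)
      = (if l = i then 𝔼 q, f q else 1) * if l = j then 𝔼 q, g q else 1 := by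
    intro l
    rcases eq_or_ne l i with rfl | hl
    · simp [hij]
    · simp only [hl, if_false, one_mul]; split_ifs <;> simp [expect_const univ_nonempty]
  simpa only [h2, prod_mul_distrib, prod_ite_eq', mem_univ, if_true] using h

/-! ### Type 2: replacing the coefficients h by signs -/

section TypeComparison

variable {ι : Type*} [Fintype ι] [DecidableEq ι] {B : Type*} [NormedAddCommGroup B]
  [NormedSpace ℝ B]

lemma IsSymmetricStandardized.half_le_expect_abs {Q : Type*} [Fintype Q] [Nonempty Q] {h : Q → ℝ}
    (hh : IsSymmetricStandardized h) : 1 / 2 ≤ 𝔼 q, |h q| := by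
  -- With t = |h|, the difference of the two sides is t (t - 2)² (t + 4) / 16 ≥ 0.
  have h1 : 𝔼 q, (3 / 4 * h q ^ 2 - 1 / 16 * h q ^ 4) ≤ 𝔼 q, |h q| := by
    refine expect_le_expect fun q _ => ?_
    have h0 := abs_nonneg (h q)
    rw [← sq_abs, ← (by decide : Even 4).pow_abs (h q)]
    nlinarith [mul_nonneg (mul_nonneg h0 (sq_nonneg (|h q| - 2))) (by positivity : 0 ≤ |h q| + 4)]
  rw [expect_sub_distrib, ← mul_expect, ← mul_expect, hh.moment_two] at h1
  linarith [hh.moment_four]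

/-- Jensen: averaging over `ω` inside the norm replaces each coefficient by its mean. -/
lemma rademacherAvg_le_expect_rademacherAvg {Q : Type*} [Fintype Q] [Nonempty Q] (f : Q → ℝ)
    (x : ι → B) :
    (𝔼 q, f q) ^ 2 * rademacherAvg x ≤ 𝔼 ω : ι → Q, rademacherAvg fun i => f (ω i) • x i := by
  rw [← rademacherAvg_smul]
  unfold rademacherAvg
  rw [expect_comm]
  refine expect_le_expect fun s _ => ?_
  refine le_of_eq_of_le ?_ (norm_expect_sq_le _)
  congr 2
  rw [sum_comm, smul_sum]
  refine sum_congr rfl fun i _ => ?_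
  rw [← smul_sum, ← sum_smul, smul_comm _ (s i), smul_smul, ← expect_pi_apply i f,
    Fintype.expect_eq_sum_div_card, div_eq_inv_mul]

/-- Jensen needs a nonzero mean, so it is applied to |h|. Since |h| = sign(h) h, contraction leads
back to h, and (1/2)² accounts for the factor 4. -/
lemma IsSymmetricStandardized.rademacherAvg_le {Q : Type*} [Fintype Q] [Nonempty Q] {h : Q → ℝ}
    (hh : IsSymmetricStandardized h) (x : ι → B) :
    rademacherAvg x ≤ 4 * 𝔼 ω : ι → Q, ‖∑ i, h (ω i) • x i‖ ^ 2 := by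
  obtain ⟨σ, hσ⟩ := hh.symm
  rw [expect_norm_sq_eq_expect_rademacherAvg h σ hσ]
  have h1 := rademacherAvg_le_expect_rademacherAvg (fun q => |h q|) x
  have h2 : ∀ ω : ι → Q, rademacherAvg (fun i => |h (ω i)| • x i)
      ≤ rademacherAvg fun i => h (ω i) • x i := fun ω => by
    have h3 := rademacherAvg_smul_le_of_abs_le_one (fun i => h (ω i) • x i)
      (fun i => SignType.sign (h (ω i))) fun i => by
        rcases lt_trichotomy (h (ω i)) 0 with h | h | h <;> simp [h]
    simpa only [smul_smul, sign_mul_self] using h3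
  have h4 := h1.trans (expect_le_expect fun ω _ => h2 ω)
  have h5 := hh.half_le_expect_abs
  have h6 : (1 / 2 : ℝ) ^ 2 ≤ (𝔼 q, |h q|) ^ 2 := by gcongr
  nlinarith [rademacherAvg_nonneg x]

end TypeComparison

/-! ### Cotype 2: bounding coefficients h by signs -/

section CotypeComparison

variable {B : Type u} [NormedAddCommGroup B]
  [NormedSpace ℝ B]

/-- The hypothesis is applied to the block sums for all sign patterns at once, which is why one h
must serve finitely many families. Coefficients constant on blocks cost at most max_j h_j² by
contraction, and `M` bounds the mean of this maximum. -/
lemma WeakCotypeTwoWith.sum_rademacherAvg_le {c : ℝ}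
    (hB : WeakCotypeTwoWith.{u, v} B c) (n k : ℕ) {M : ℝ} (hM : 0 < M) (hk : 31 * k ≤ M ^ 3)
    (J : Fin n → Option (Fin k)) (x : Fin n → B) :
    c * ∑ j, rademacherAvg (fun i => if J i = some j then x i else 0) ≤ M * rademacherAvg x := by
  obtain ⟨Q, _, _, h, hh, hc⟩ := hB k (Fin n → ℤˣ)
    fun s j => ∑ i, s i • if J i = some j then x i else 0
  have h1 : ∀ (ω : Fin k → Q) (s : Fin n → ℤˣ),
      ∑ j, h (ω j) • ∑ i, s i • (if J i = some j then x i else 0)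
        = ∑ i, s i • ((J i).elim 0 fun j => h (ω j)) • x i := by
    intro ω s
    simp_rw [smul_sum]
    rw [sum_comm]
    refine sum_congr rfl fun i _ => ?_
    simp_rw [smul_comm _ (s i), ← smul_sum]
    congr 1
    rcases hJ : J i with _ | j
    · simp
    · simp
  have h2 : c * ∑ j, rademacherAvg (fun i => if J i = some j then x i else 0)
      ≤ 𝔼 ω : Fin k → Q, rademacherAvg fun i => ((J i).elim 0 fun j => h (ω j)) • x i := by
    unfold rademacherAvg
    rw [expect_comm, ← expect_sum_comm, mul_expect]
    refine expect_le_expect fun s _ => (hc s).trans (le_of_eq ?_)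
    exact expect_congr rfl fun ω _ => by rw [h1]
  have h3 : ∀ ω : Fin k → Q,
      rademacherAvg (fun i => ((J i).elim 0 fun j => h (ω j)) • x i)
        ≤ (2 / 3 * M + 1 / (3 * M ^ 2) * ∑ j, h (ω j) ^ 6) * rademacherAvg x := by
    intro ω
    refine rademacherAvg_contraction _ _ (by positivity) fun i => ?_
    rcases J i with _ | j
    · simp only [Option.elim_none]; rw [zero_pow two_ne_zero]; positivity
    · simp only [Option.elim_some]
      have h4 : h (ω j) ^ 6 ≤ ∑ j, h (ω j) ^ 6 :=
        single_le_sum (f := fun j => h (ω j) ^ 6) (fun _ _ => by positivity) (mem_univ j)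
      have h5 : h (ω j) ^ 2 ≤ 2 / 3 * M + 1 / (3 * M ^ 2) * h (ω j) ^ 6 := by
        set y := h (ω j) ^ 2 with hy
        have hy0 : 0 ≤ y := sq_nonneg _
        have h6 : h (ω j) ^ 6 = y ^ 3 := by rw [hy]; ring
        rw [h6, ← sub_le_iff_le_add', one_div_mul_eq_div, le_div_iff₀ (by positivity)]
        -- y³ - 3M²y + 2M³ = (y - M)² (y + 2M).
        nlinarith [mul_nonneg (sq_nonneg (y - M)) (by positivity : 0 ≤ y + 2 * M)]
      exact h5.trans (by gcongr)
  refine h2.trans ((expect_le_expect fun ω _ => h3 ω).trans ?_)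
  rw [← expect_mul]
  refine mul_le_mul_of_nonneg_right ?_ (rademacherAvg_nonneg x)
  rw [expect_add_distrib, expect_const univ_nonempty, ← mul_expect, expect_sum_comm]
  simp_rw [expect_pi_apply (Q := Q) _ fun q => h q ^ 6]
  rw [sum_const, card_univ, Fintype.card_fin, nsmul_eq_mul]
  have h7 : 1 / (3 * M ^ 2) * (k * 𝔼 q, h q ^ 6) ≤ 1 / 3 * M := by
    rw [div_mul_eq_mul_div, div_le_iff₀ (by positivity)]
    have : (k : ℝ) * 𝔼 q, h q ^ 6 ≤ k * 31 := by gcongr; exact hh.moment_six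
    nlinarith
  linarith

/-- `Q` has room for `k` disjoint copies of `A`; `π j` carries the j-th copy onto `A` and its
complement off `A`. -/
lemma exists_perm_disjoint_preimages {Q : Type*} [Fintype Q] [DecidableEq Q] (A : Finset Q)
    (k : ℕ) (hk : #A * k ≤ Fintype.card Q) :
    ∃ π : Fin k → Equiv.Perm Q, ∀ q j j', π j q ∈ A → π j' q ∈ A → j = j' := by
  obtain ⟨f⟩ : Nonempty (Fin k × A ↪ Q) :=
    Function.Embedding.nonempty_of_card_le (by simpa [mul_comm] using hk)
  have he : ∀ j, ∃ e : Equiv.Perm Q, ∀ q, e q ∈ A → ∃ a, f (j, a) = q := by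
    intro j
    let g : A → Q := fun a => f (j, a)
    have hg : Function.Injective g := fun a b hab => by simpa using f.injective hab
    let e : {q // q ∈ Set.range g} ≃ {q // q ∈ A} := (Equiv.ofInjective g hg).symm
    classical
    refine ⟨e.extendSubtype, fun q hq => ?_⟩
    by_contra hne
    exact e.extendSubtype_not_mem q hne hq
  choose π hπ using he
  refine ⟨π, fun q j j' h h' => ?_⟩
  obtain ⟨a, ha⟩ := hπ j q h
  obtain ⟨b, hb⟩ := hπ j' q h'
  exact congrArg Prod.fst (f.injective (ha.trans hb.symm))

/-- For fixed `ω` the events π_j(ω_i) ∈ A define disjoint blocks of indices i. Each π_j preserves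
the uniform distribution, so all `k` blocks contribute the same mean. -/
lemma WeakCotypeTwoWith.expect_rademacherAvg_indicator_le {c : ℝ}
    (hB : WeakCotypeTwoWith.{u, v} B c) {n k : ℕ} {M : ℝ} (hM : 0 < M) (hk : 31 * k ≤ M ^ 3)
    {Q : Type*} [Fintype Q] [DecidableEq Q] [Nonempty Q] (A : Finset Q)
    (hA : #A * k ≤ Fintype.card Q) (x : Fin n → B) :
    c * (k * 𝔼 ω : Fin n → Q, rademacherAvg (fun i => if ω i ∈ A then x i else 0))
      ≤ M * rademacherAvg x := by
  obtain ⟨π, hπ⟩ := exists_perm_disjoint_preimages A k hA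
  have h1 : ∀ j, 𝔼 ω : Fin n → Q, rademacherAvg (fun i => if π j (ω i) ∈ A then x i else 0)
      = 𝔼 ω : Fin n → Q, rademacherAvg (fun i => if ω i ∈ A then x i else 0) := fun j =>
    Fintype.expect_equiv (Equiv.piCongrRight fun _ => π j) _ _ fun ω => rfl
  have h2 : ∀ ω : Fin n → Q,
      c * ∑ j, rademacherAvg (fun i => if π j (ω i) ∈ A then x i else 0)
        ≤ M * rademacherAvg x := by
    intro ω
    have hJ : ∀ i, ∃ o : Option (Fin k), ∀ j, π j (ω i) ∈ A ↔ o = some j := by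
      intro i
      by_cases h : ∃ j, π j (ω i) ∈ A
      · obtain ⟨j, hj⟩ := h
        refine ⟨some j, fun j' => ⟨fun h' => by rw [hπ _ _ _ hj h'], fun h' => ?_⟩⟩
        rwa [← Option.some.inj h']
      · push Not at h
        exact ⟨none, fun j => by simp [h j]⟩
    choose J hJ using hJ
    simp_rw [hJ]
    exact hB.sum_rademacherAvg_le n k hM hk J x
  have h3 := expect_le_expect (s := univ) fun ω _ => h2 ω
  rw [expect_const univ_nonempty, ← mul_expect, expect_sum_comm] at h3
  simpa [h1] using h3

/-- The level is the least admissible one, so |h| > 2^(l+1) on level l ≥ 1, and Markov's inequality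
for h⁶ applies. The offset 2 in the exponent gains a factor 64, which absorbs the moment bound 31.
-/
lemma exists_dyadic_level {Q : Type*} [Fintype Q] [Nonempty Q] (h : Q → ℝ)
    (h6 : 𝔼 q, h q ^ 6 ≤ 31) :
    ∃ (L : ℕ) (ℓ : Q → ℕ), (∀ q, ℓ q < L) ∧ (∀ q, |h q| ≤ 2 ^ (ℓ q + 2)) ∧
      ∀ l, #{q | ℓ q = l} * 64 ^ l ≤ Fintype.card Q := by
  classical
  have hex : ∀ q, ∃ l : ℕ, |h q| ≤ 2 ^ (l + 2) := fun q => by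
    obtain ⟨l, hl⟩ := pow_unbounded_of_one_lt |h q| (one_lt_two (α := ℝ))
    exact ⟨l, hl.le.trans (pow_le_pow_right₀ one_le_two (by omega))⟩
  refine ⟨univ.sup (fun q => Nat.find (hex q)) + 1, fun q => Nat.find (hex q),
    fun q => Nat.lt_succ_of_le (le_sup (f := fun q => Nat.find (hex q)) (mem_univ q)),
    fun q => Nat.find_spec (hex q), fun l => ?_⟩
  rcases l with _ | l
  · simpa using card_le_univ _
  · have h1 : ∀ q ∈ ({q | Nat.find (hex q) = l + 1} : Finset Q), (64 : ℝ) ^ (l + 2) ≤ h q ^ 6 := by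
      intro q hq
      have h2 : ¬ |h q| ≤ 2 ^ (l + 2) := Nat.find_min (hex q) (by simp at hq; omega)
      have h3 : ((2 : ℝ) ^ (l + 2)) ^ 6 ≤ |h q| ^ 6 :=
        pow_le_pow_left₀ (by positivity) (not_le.1 h2).le 6
      rw [(by decide : Even 6).pow_abs, ← pow_mul, mul_comm, pow_mul] at h3
      norm_num at h3 ⊢
      exact h3
    have h2 : #{q | Nat.find (hex q) = l + 1} * (64 : ℝ) ^ (l + 2) ≤ ∑ q, h q ^ 6 := by
      rw [← nsmul_eq_mul]
      exact (card_nsmul_le_sum _ _ _ h1).trans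
        (sum_le_univ_sum_of_nonneg fun q => by positivity)
    have hc : (0 : ℝ) < Fintype.card Q := by exact_mod_cast Fintype.card_pos
    rw [Fintype.expect_eq_sum_div_card, div_le_iff₀ hc] at h6
    have h3 : (#{q | Nat.find (hex q) = l + 1} * 64 ^ (l + 1) : ℝ) ≤ Fintype.card Q := by
      rw [pow_succ] at h2
      linarith
    exact_mod_cast h3

lemma WeakCotypeTwoWith.le_rademacherAvg {c : ℝ} (hc : 0 < c)
    (hB : WeakCotypeTwoWith.{u, v} B c) {n : ℕ} (x : Fin n → B) :
    c ^ 2 / 256 * ∑ i, ‖x i‖ ^ 2 ≤ rademacherAvg x := by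
  obtain ⟨Q, _, _, h, hh, hle⟩ := hB n Unit fun _ => x
  classical
  obtain ⟨σ, hσ⟩ := hh.symm
  replace hle := hle ()
  rw [expect_norm_sq_eq_expect_rademacherAvg h σ hσ] at hle
  obtain ⟨L, ℓ, hL, hℓ, hcard⟩ := exists_dyadic_level h hh.moment_six
  have hR := rademacherAvg_nonneg x
  have h1 : ∀ ω : Fin n → Q, rademacherAvg (fun i => h (ω i) • x i)
      ≤ ∑ l ∈ range L, 2 ^ (l + 1) * ((4 ^ (l + 2)) *
          rademacherAvg fun i => if ω i ∈ ({q | ℓ q = l} : Finset Q) then x i else 0) := by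
    intro ω
    have h2 : (fun i => h (ω i) • x i) = fun i => ∑ l ∈ range L,
        (if ℓ (ω i) = l then h (ω i) else 0) •
          if ω i ∈ ({q | ℓ q = l} : Finset Q) then x i else 0 := by
      ext i
      rw [sum_eq_single_of_mem (ℓ (ω i)) (mem_range.2 (hL _))]
      · simp
      · intro l _ hl; simp [hl.symm]
    rw [h2]
    refine (rademacherAvg_sum_le L _).trans (sum_le_sum fun l _ => ?_)
    refine mul_le_mul_of_nonneg_left ?_ (by positivity)
    refine rademacherAvg_contraction _ _ (by positivity) fun i => ?_
    split_ifs with hl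
    · have h3 := hℓ (ω i)
      rw [hl] at h3
      rw [← sq_abs, show (4 : ℝ) = 2 ^ 2 by norm_num, ← pow_mul, mul_comm, pow_mul]
      gcongr
    · rw [zero_pow two_ne_zero]; positivity
  have h4 : ∀ l, 𝔼 ω : Fin n → Q,
      rademacherAvg (fun i => if ω i ∈ ({q | ℓ q = l} : Finset Q) then x i else 0)
        ≤ 4 / c * (1 / 16) ^ l * rademacherAvg x := by
    intro l
    -- Here M³ = 64 k ≥ 31 k, and M / k = 4 · 16^(-l).
    have h5 := hB.expect_rademacherAvg_indicator_le (k := 64 ^ l) (M := 4 * 4 ^ l) (by positivity)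
      (by
        push_cast
        rw [mul_pow, ← pow_mul, mul_comm l, pow_mul]
        norm_num)
      ({q | ℓ q = l} : Finset Q) (hcard l) x
    push_cast at h5
    have h16 : ((1 : ℝ) / 16) ^ l = 4 ^ l / 64 ^ l := by rw [← div_pow]; norm_num
    have h64 : (0 : ℝ) < 64 ^ l := by positivity
    rw [← mul_assoc, ← le_div_iff₀' (by positivity)] at h5
    refine h5.trans (le_of_eq ?_)
    rw [h16]; field_simp
  have h6 : 𝔼 ω : Fin n → Q, rademacherAvg (fun i => h (ω i) • x i)
      ≤ 256 / c * rademacherAvg x := by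
    refine (expect_le_expect fun ω _ => h1 ω).trans ?_
    rw [expect_sum_comm]
    -- The constants combine to 2 · 16 · 4/c = 128/c, the powers to (2 · 4 / 16)^l.
    have h7 : ∀ l ∈ range L, 𝔼 ω : Fin n → Q, (2 ^ (l + 1) * ((4 ^ (l + 2)) *
        rademacherAvg fun i => if ω i ∈ ({q | ℓ q = l} : Finset Q) then x i else 0))
          ≤ 128 / c * rademacherAvg x * (1 / 2) ^ l := by
      intro l _
      rw [← mul_expect, ← mul_expect]
      refine (mul_le_mul_of_nonneg_left (mul_le_mul_of_nonneg_left (h4 l) (by positivity))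
        (by positivity)).trans (le_of_eq ?_)
      have h8 : ((1 : ℝ) / 2) ^ l = 2 ^ l * 4 ^ l * (1 / 16) ^ l := by
        rw [← mul_pow, ← mul_pow]; norm_num
      rw [h8]; ring
    refine (sum_le_sum h7).trans ?_
    rw [← mul_sum]
    have h9 : ∑ l ∈ range L, ((1 : ℝ) / 2) ^ l ≤ 2 := sum_geometric_two_le L
    calc _ ≤ 128 / c * rademacherAvg x * 2 := by gcongr
      _ = _ := by ring
  have h10 := hle.trans h6
  rw [div_mul_eq_mul_div, le_div_iff₀ hc] at h10
  nlinarith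

end CotypeComparison

/-! ### Symmetric steps and moments of their random walks -/

/-- A symmetric random variable with values in `{-1, 0, 1}` and with variance `p`, defined on the
finite set `S` with the uniform distribution. -/
structure IsSymmetricStep {S : Type*} [Fintype S] (a : S → ℝ) (p : ℝ) : Prop where
  symm : ∃ σ : Equiv.Perm S, ∀ s, a (σ s) = -a s
  cube : ∀ s, a s ^ 3 = a s
  moment_two : 𝔼 s, a s ^ 2 = p

namespace IsSymmetricStep

section Walk

variable {S : Type*} [Fintype S] [Nonempty S] {a : S → ℝ} {p : ℝ}

lemma expect_eq_zero (ha : IsSymmetricStep a p) : 𝔼 s, a s = 0 := by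
  obtain ⟨σ, hσ⟩ := ha.symm
  have h1 : 𝔼 s, a s = 𝔼 s, -a s := (Fintype.expect_equiv σ _ _ fun s => (hσ s).symm).symm
  rw [expect_neg_distrib] at h1
  linarith

lemma nonneg (ha : IsSymmetricStep a p) : 0 ≤ p := by
  rw [← ha.moment_two]
  exact expect_nonneg fun _ _ => sq_nonneg _

/-- Since a³ = a, every polynomial in a reduces to a quadratic one, so this suffices for all the
moment recursions below. -/
lemma expect_quadratic (ha : IsSymmetricStep a p) (x y z : ℝ) :
    𝔼 s, (x + y * a s + z * a s ^ 2) = x + z * p := by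
  rw [expect_add_distrib, expect_add_distrib, expect_const univ_nonempty, ← mul_expect,
    ← mul_expect, ha.expect_eq_zero, ha.moment_two, mul_zero, add_zero]

lemma expect_walk_succ (a : S → ℝ) (m : ℕ) (F : ℝ → ℝ) :
    𝔼 τ : Fin (m + 1) → S, F (∑ u, a (τ u))
      = 𝔼 τ : Fin m → S, 𝔼 s, F (∑ u, a (τ u) + a s) := by
  rw [← expect_product', univ_product_univ]
  refine (Fintype.expect_equiv ((Equiv.prodComm _ _).trans (Fin.consEquiv fun _ => S)) _ _ ?_).symm
  rintro ⟨τ, s⟩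
  simp [Fin.sum_univ_succ, add_comm]

lemma walk_moment_two (ha : IsSymmetricStep a p) (m : ℕ) :
    𝔼 τ : Fin m → S, (∑ u, a (τ u)) ^ 2 = m * p := by
  induction m with
  | zero => simp
  | succ m ih =>
    rw [expect_walk_succ a m fun t => t ^ 2]
    have h (t : ℝ) : 𝔼 s, (t + a s) ^ 2 = t ^ 2 + 1 * p := by
      rw [← ha.expect_quadratic (t ^ 2) (2 * t) 1]
      exact expect_congr rfl fun s _ => by ring
    simp_rw [h]
    rw [expect_add_distrib, ih, expect_const univ_nonempty]
    push_cast; ring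

lemma walk_moment_four_le (ha : IsSymmetricStep a p) (m : ℕ) :
    𝔼 τ : Fin m → S, (∑ u, a (τ u)) ^ 4 ≤ 3 * (m * p) ^ 2 + m * p := by
  induction m with
  | zero => simp
  | succ m ih =>
    rw [expect_walk_succ a m fun t => t ^ 4]
    have h (t : ℝ) : 𝔼 s, (t + a s) ^ 4 = t ^ 4 + (6 * t ^ 2 + 1) * p := by
      rw [← ha.expect_quadratic (t ^ 4) (4 * t ^ 3 + 4 * t) (6 * t ^ 2 + 1)]
      exact expect_congr rfl fun s _ => by linear_combination (4 * t + a s) * ha.cube s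
    simp_rw [h]
    rw [expect_add_distrib, ← expect_mul, expect_add_distrib, ← mul_expect,
      ha.walk_moment_two, expect_const univ_nonempty]
    push_cast
    nlinarith [sq_nonneg p]

lemma walk_moment_six_le (ha : IsSymmetricStep a p) (m : ℕ) :
    𝔼 τ : Fin m → S, (∑ u, a (τ u)) ^ 6 ≤ 15 * (m * p) ^ 3 + 15 * (m * p) ^ 2 + m * p := by
  induction m with
  | zero => simp
  | succ m ih =>
    rw [expect_walk_succ a m fun t => t ^ 6]
    have h (t : ℝ) : 𝔼 s, (t + a s) ^ 6 = t ^ 6 + (15 * t ^ 4 + 15 * t ^ 2 + 1) * p := by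
      rw [← ha.expect_quadratic (t ^ 6) (6 * t ^ 5 + 20 * t ^ 3 + 6 * t)
        (15 * t ^ 4 + 15 * t ^ 2 + 1)]
      exact expect_congr rfl fun s _ => by
        linear_combination
          (20 * t ^ 3 + 15 * t ^ 2 * a s + 6 * t * (a s ^ 2 + 1) + a s ^ 3 + a s) * ha.cube s
    simp_rw [h]
    rw [expect_add_distrib, ← expect_mul, expect_add_distrib, expect_add_distrib, ← mul_expect,
      ← mul_expect, ha.walk_moment_two, expect_const univ_nonempty]
    have hp := ha.nonneg
    have h4 := mul_le_mul_of_nonneg_right (ha.walk_moment_four_le m) hp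
    have hm : 0 ≤ (m : ℝ) * p := by positivity
    push_cast
    nlinarith [mul_nonneg hm (sq_nonneg p), pow_nonneg hp 3, sq_nonneg p]

/-- Once mp ≥ 1 the lower powers of mp are absorbed by the leading one: 3 + 1 = 4 and 15 + 15 + 1 =
31. -/
lemma isSymmetricStandardized (ha : IsSymmetricStep a p) {m : ℕ} (hm : 1 ≤ m * p) :
    IsSymmetricStandardized fun τ : Fin m → S => (√(m * p))⁻¹ * ∑ u, a (τ u) := by
  have h0 : 0 < m * p := by linarith
  have hs : (√(m * p))⁻¹ ^ 2 = (m * p)⁻¹ := by rw [inv_pow, Real.sq_sqrt h0.le]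
  have hs4 : (√(m * p))⁻¹ ^ 4 = (m * p)⁻¹ ^ 2 := by rw [← hs]; ring
  have hs6 : (√(m * p))⁻¹ ^ 6 = (m * p)⁻¹ ^ 3 := by rw [← hs]; ring
  obtain ⟨σ, hσ⟩ := ha.symm
  refine ⟨⟨Equiv.piCongrRight fun _ => σ, fun τ => by simp [hσ]⟩, ?_, ?_, ?_⟩
  · simp_rw [mul_pow]
    rw [← mul_expect, ha.walk_moment_two, hs, inv_mul_cancel₀ h0.ne']
  · simp_rw [mul_pow]
    rw [← mul_expect, hs4, inv_pow, inv_mul_le_iff₀ (by positivity)]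
    refine (ha.walk_moment_four_le m).trans ?_
    nlinarith
  · simp_rw [mul_pow]
    rw [← mul_expect, hs6, inv_pow, inv_mul_le_iff₀ (by positivity)]
    refine (ha.walk_moment_six_le m).trans ?_
    nlinarith [mul_le_mul_of_nonneg_left hm (sq_nonneg (m * p))]

end Walk

/-! ### Vector sums with sparse random coefficients -/

section Vector

variable {S : Type*} [Fintype S] [Nonempty S] {a : S → ℝ} {p : ℝ} {ι : Type*} [Fintype ι]
  [DecidableEq ι] {B : Type*} [NormedAddCommGroup B] [NormedSpace ℝ B]

/-- The coefficients lie in {-1, 0, 1}, so |b| = |b|², and Cauchy–Schwarz applies. -/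
lemma _root_.BanachType.norm_sum_smul_sq_le (b : ι → ℝ) (hb : ∀ i, b i ^ 3 = b i) (x : ι → B) :
    ‖∑ i, b i • x i‖ ^ 2 ≤ (∑ j, b j ^ 2) * ∑ i, b i ^ 2 * ‖x i‖ ^ 2 := by
  have h1 : ‖∑ i, b i • x i‖ ≤ ∑ i, |b i| * (|b i| * ‖x i‖) := by
    refine (norm_sum_le _ _).trans (sum_le_sum fun i _ => le_of_eq ?_)
    rw [norm_smul, Real.norm_eq_abs, ← mul_assoc, abs_mul_abs_self]
    congr 1
    have h2 : b i = 0 ∨ b i = 1 ∨ b i = -1 := by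
      have h3 : b i * ((b i - 1) * (b i + 1)) = 0 := by linear_combination hb i
      simpa [sub_eq_zero, add_eq_zero_iff_eq_neg] using h3
    rcases h2 with h | h | h <;> simp [h]
  refine (pow_le_pow_left₀ (norm_nonneg _) h1 2).trans ((sum_mul_sq_le_sq_mul_sq _ _ _).trans ?_)
  simp [mul_pow]

/-- With two or more nonzero coefficients the left side is at most 0; with one or none there is
equality. -/
lemma _root_.BanachType.le_norm_sum_smul_sq (b : ι → ℝ) (hb : ∀ i, b i ^ 3 = b i) (x : ι → B) :
    (2 - ∑ j, b j ^ 2) * ∑ i, b i ^ 2 * ‖x i‖ ^ 2 ≤ ‖∑ i, b i • x i‖ ^ 2 := by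
  have hb1 : ∀ i, b i ≠ 0 → b i ^ 2 = 1 := fun i hi =>
    mul_right_cancel₀ hi (by linear_combination hb i)
  by_cases h0 : ∃ i, b i ≠ 0
  · obtain ⟨i, hi⟩ := h0
    by_cases h1 : ∃ j, j ≠ i ∧ b j ≠ 0
    · obtain ⟨j, hji, hj⟩ := h1
      have h2 : 2 ≤ ∑ j, b j ^ 2 := by
        have h3 := sum_le_univ_sum_of_nonneg (s := {i, j}) fun l => sq_nonneg (b l)
        rw [sum_pair hji.symm, hb1 i hi, hb1 j hj] at h3
        linarith
      have h4 : 0 ≤ ∑ i, b i ^ 2 * ‖x i‖ ^ 2 := sum_nonneg fun _ _ => by positivity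
      nlinarith [sq_nonneg ‖∑ i, b i • x i‖]
    · push Not at h1
      rw [sum_eq_single_of_mem i (mem_univ i) fun j _ hj => by simp [h1 j hj],
        sum_eq_single_of_mem i (mem_univ i) fun j _ hj => by simp [h1 j hj],
        sum_eq_single_of_mem i (mem_univ i) fun j _ hj => by simp [h1 j hj],
        norm_smul, mul_pow, Real.norm_eq_abs, sq_abs, hb1 i hi]
      linarith
  · push Not at h0
    simp [h0]

/-- The diagonal term gives p and every other term p², in total at most p + p/2. -/
lemma expect_sq_mul_sum_sq_le (ha : IsSymmetricStep a p) (hp : Fintype.card ι * p ≤ 1 / 2) (i : ι) :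
    𝔼 w : ι → S, (∑ j, a (w j) ^ 2) * a (w i) ^ 2 ≤ 3 / 2 * p := by
  simp_rw [sum_mul]
  rw [expect_sum_comm]
  have hp0 := ha.nonneg
  have h1 : ∀ j, 𝔼 w : ι → S, a (w j) ^ 2 * a (w i) ^ 2 ≤ p ^ 2 + if j = i then p else 0 := by
    intro j
    split_ifs with h
    · subst h
      have h2 : 𝔼 w : ι → S, a (w j) ^ 2 * a (w j) ^ 2 = p := by
        rw [← ha.moment_two, ← expect_pi_apply j fun s => a s ^ 2]
        exact expect_congr rfl fun w _ => by linear_combination a (w j) * ha.cube (w j)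
      rw [h2]
      nlinarith
    · rw [expect_pi_apply_mul_apply h (fun s => a s ^ 2) fun s => a s ^ 2, ha.moment_two]
      linarith [sq p]
  refine (sum_le_sum fun j _ => h1 j).trans ?_
  simp only [sum_add_distrib, sum_const, card_univ, nsmul_eq_mul, sum_ite_eq', mem_univ, if_true]
  nlinarith

lemma expect_norm_sq_le (ha : IsSymmetricStep a p) (hp : Fintype.card ι * p ≤ 1 / 2) (x : ι → B) :
    𝔼 w : ι → S, ‖∑ i, a (w i) • x i‖ ^ 2 ≤ 3 / 2 * p * ∑ i, ‖x i‖ ^ 2 := by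
  refine (expect_le_expect fun w _ =>
    norm_sum_smul_sq_le (fun i => a (w i)) (fun i => ha.cube (w i)) x).trans ?_
  simp_rw [mul_sum (s := univ)]
  rw [expect_sum_comm]
  refine sum_le_sum fun i _ => ?_
  simp_rw [← mul_assoc]
  rw [← expect_mul]
  exact mul_le_mul_of_nonneg_right (ha.expect_sq_mul_sum_sq_le hp i) (by positivity)

lemma le_expect_norm_sq (ha : IsSymmetricStep a p) (hp : Fintype.card ι * p ≤ 1 / 2) (x : ι → B) :
    1 / 2 * p * ∑ i, ‖x i‖ ^ 2 ≤ 𝔼 w : ι → S, ‖∑ i, a (w i) • x i‖ ^ 2 := by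
  refine le_trans ?_ (expect_le_expect fun w _ =>
    le_norm_sum_smul_sq (fun i => a (w i)) (fun i => ha.cube (w i)) x)
  simp_rw [mul_sum (s := univ)]
  rw [expect_sum_comm]
  refine sum_le_sum fun i _ => ?_
  simp_rw [← mul_assoc]
  rw [← expect_mul]
  refine mul_le_mul_of_nonneg_right ?_ (by positivity)
  simp_rw [sub_mul]
  rw [expect_sub_distrib, ← mul_expect, expect_pi_apply i fun s => a s ^ 2, ha.moment_two]
  linarith [ha.expect_sq_mul_sum_sq_le hp i]

lemma expect_sum_smul_eq_zero (ha : IsSymmetricStep a p) (x : ι → B) :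
    ∑ w : ι → S, ∑ i, a (w i) • x i = 0 := by
  rw [sum_comm]
  refine sum_eq_zero fun i _ => ?_
  rw [← sum_smul]
  have h1 := (expect_pi_apply i a).trans ha.expect_eq_zero
  rw [Fintype.expect_eq_sum_div_card, div_eq_zero_iff] at h1
  rw [h1.resolve_right (by exact_mod_cast Fintype.card_ne_zero), zero_smul]

/-- The sum of m copies of ∑ a_i x_i, regrouped by i, has independent walks as coefficients. -/
lemma _root_.BanachType.expect_norm_walk_sq (a : S → ℝ) {p : ℝ} {m : ℕ} (hm : 1 ≤ m * p) (x : ι → B) :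
    𝔼 ω : Fin m → ι → S, ‖∑ u, ∑ i, a (ω u i) • x i‖ ^ 2
      = m * p * 𝔼 ω : ι → Fin m → S, ‖∑ i, ((√(m * p))⁻¹ * ∑ u, a (ω i u)) • x i‖ ^ 2 := by
  have h0 : 0 < m * p := by linarith
  rw [mul_expect]
  refine Fintype.expect_equiv (Equiv.piComm fun _ _ => S) _ _ fun ω => ?_
  rw [sum_comm]
  simp_rw [mul_smul, ← smul_sum, norm_smul, mul_pow, sum_smul, Equiv.piComm_apply,
    Function.swap]
  rw [norm_inv, inv_pow, Real.norm_eq_abs, sq_abs, Real.sq_sqrt h0.le,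
    mul_inv_cancel_left₀ h0.ne']

end Vector

lemma exists_step (n : ℕ) : ∃ (S : Type v) (_ : Fintype S) (_ : Nonempty S) (a : S → ℝ) (p : ℝ),
    0 < p ∧ n * p ≤ 1 / 2 ∧ IsSymmetricStep a p := by
  -- A random sign, kept with probability 1/(2n + 1), which is positive even for n = 0.
  refine ⟨ULift (ℤˣ × Fin (2 * n + 1)), inferInstance, inferInstance,
    fun s => if s.down.2 = 0 then ((s.down.1 : ℤ) : ℝ) else 0, 1 / (2 * n + 1), by positivity,
    ?_, ⟨?_, ?_, ?_⟩⟩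
  · rw [mul_one_div, div_le_div_iff₀ (by positivity) two_pos]
    linarith
  · refine ⟨(Equiv.ulift.trans ((Equiv.neg ℤˣ).prodCongr (Equiv.refl _))).trans Equiv.ulift.symm,
      fun s => ?_⟩
    simp only [Equiv.trans_apply, Equiv.ulift_symm_apply, Equiv.ulift_apply,
      Equiv.prodCongr_apply, Prod.map, Equiv.refl_apply, Equiv.neg_apply]
    split_ifs <;> simp
  · intro s
    split_ifs
    · rcases Int.units_eq_one_or s.down.1 with h | h <;> simp [h]; norm_num
    · simp
  · rw [Fintype.expect_eq_sum_div_card, Fintype.sum_equiv Equiv.ulift _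
      (fun s : ℤˣ × Fin (2 * n + 1) => if s.2 = 0 then (1 : ℝ) else 0), Fintype.sum_prod_type]
    · simp
      field_simp
    · rintro ⟨s, q⟩
      rcases Int.units_eq_one_or s with h | h <;> simp [h]

end IsSymmetricStep

/-! ### From i.i.d. sums to the weak inequalities -/

section IID

variable {B : Type u} [NormedAddCommGroup B] [NormedSpace ℝ B] [MeasurableSpace B]

lemma lintegral_pi_uniform {W : Type*} [Fintype W] [Nonempty W] [MeasurableSpace W]
    [MeasurableSingletonClass W] {α : Type*} [Fintype α] [DecidableEq α]
    (g : (α → W) → B) :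
    ∫⁻ ω, ‖g ω‖ₑ ^ 2 ∂(Measure.pi fun _ : α => (PMF.uniformOfFintype W).toMeasure)
      = ENNReal.ofReal (𝔼 ω, ‖g ω‖ ^ 2) := by
  have hW : (0 : ℝ) < Fintype.card W := by exact_mod_cast Fintype.card_pos
  rw [lintegral_fintype, Fintype.expect_eq_sum_div_card, sum_div,
    ENNReal.ofReal_sum_of_nonneg fun _ _ => by positivity]
  refine sum_congr rfl fun ω _ => ?_
  rw [Measure.pi_singleton]
  simp only [PMF.toMeasure_apply_singleton _ _ (measurableSet_singleton _),
    PMF.uniformOfFintype_apply, prod_const, card_univ, Fintype.card_pi]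
  rw [div_eq_mul_inv, ENNReal.ofReal_mul (by positivity), ENNReal.ofReal_pow (norm_nonneg _),
    ofReal_norm, ENNReal.ofReal_inv_of_pos (by push_cast; positivity), ENNReal.ofReal_natCast]
  push_cast
  rw [ENNReal.inv_pow]

/-- Independent copies of a finitely supported random variable. -/
lemma exists_iid [BorelSpace B] [CompleteSpace B] [SecondCountableTopology B] {W : Type v} [Fintype W] [Nonempty W]
    (f : W → B) (hf : ∑ w, f w = 0) :
    ∃ (Ω : Type v) (_ : MeasurableSpace Ω) (P : Measure Ω) (_ : IsProbabilityMeasure P)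
      (X : ℕ → Ω → B), IsIIDL2Zero P X ∧
        secondMoment P (X 0) = ENNReal.ofReal (𝔼 w, ‖f w‖ ^ 2) ∧
        ∀ m, secondMoment P (partialSum X m)
          = ENNReal.ofReal (𝔼 ω : Fin m → W, ‖∑ u, f (ω u)‖ ^ 2) := by
  let _ : MeasurableSpace W := ⊤
  set μ : Measure W := (PMF.uniformOfFintype W).toMeasure with hμ
  have hfm : Measurable f := measurable_from_top
  have hpres : ∀ i, MeasurePreserving (fun ω : ℕ → W => ω i)
      (Measure.infinitePi fun _ : ℕ => μ) μ := fun i => measurePreserving_eval_infinitePi _ i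
  have hfi : ∀ i, Measurable fun ω : ℕ → W => f (ω i) := fun i => hfm.comp (hpres i).measurable
  have hfL : MemLp f 2 μ := MemLp.of_discrete
  have hsum : ∀ m, secondMoment (Measure.infinitePi fun _ : ℕ => μ)
      (partialSum (fun i (ω : ℕ → W) => f (ω i)) m)
        = ENNReal.ofReal (𝔼 ω : Fin m → W, ‖∑ u, f (ω u)‖ ^ 2) := by
    intro m
    have hmap : (Measure.infinitePi fun _ : ℕ => μ).map (fun ω (i : Fin m) => ω i)
        = Measure.pi fun _ : Fin m => μ := by
      rw [← Measure.infinitePi_eq_pi]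
      exact Measure.map_infinitePi_infinitePi_of_inj (P := fun _ : ℕ => μ) Fin.val_injective
    rw [← lintegral_pi_uniform, ← hmap, lintegral_map (measurable_of_finite _) (by fun_prop)]
    simp only [secondMoment, partialSum, Finset.sum_range]
  refine ⟨ℕ → W, inferInstance, Measure.infinitePi fun _ => μ, inferInstance,
    fun i ω => f (ω i), ⟨iIndepFun_infinitePi fun _ => hfm, fun i => ?_, fun i => ?_⟩, ?_, hsum⟩
  · refine ⟨(hfi i).aemeasurable, (hfi 0).aemeasurable, ?_⟩
    have h : ∀ i, (Measure.infinitePi fun _ : ℕ => μ).map (fun ω => f (ω i)) = μ.map f := fun i => by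
      exact (Measure.map_map hfm (hpres i).measurable).symm.trans (by rw [(hpres i).map_eq])
    rw [h, h]
  · refine ⟨hfi i, hfL.comp_measurePreserving (hpres i), ?_⟩
    have h := integral_map (μ := Measure.infinitePi fun _ : ℕ => μ) (φ := fun ω : ℕ → W => ω i)
      (hpres i).measurable.aemeasurable (f := f) (by rw [(hpres i).map_eq]; exact hfL.1)
    rw [← h, (hpres i).map_eq, integral_fintype (hfL.integrable (by norm_num))]
    have h2 : ∀ w, μ.real {w} = (Fintype.card W : ℝ)⁻¹ := fun w => by
      rw [Measure.real, hμ, PMF.toMeasure_apply_singleton _ _ (measurableSet_singleton _)]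
      simp
    simp_rw [h2]
    rw [← smul_sum, hf, smul_zero]
  · have h := hsum 1
    refine (Eq.trans ?_ h).trans ?_
    · simp [secondMoment, partialSum]
    · congr 1
      exact Fintype.expect_equiv (Equiv.funUnique (Fin 1) W) _ _ fun ω => by simp

lemma LimsupWith.eventually_le [BorelSpace B] [CompleteSpace B]
    [SecondCountableTopology B] {c : ℝ≥0} (hc : 0 < c)
    (hB : LimsupWith.{u, v} B c) {W : Type v} [Fintype W] [Nonempty W] (f : W → B)
    (hf : ∑ w, f w = 0) :
    ∀ᶠ m : ℕ in atTop, 𝔼 ω : Fin m → W, ‖∑ u, f (ω u)‖ ^ 2 ≤ 2 * c * m * 𝔼 w, ‖f w‖ ^ 2 := by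
  obtain ⟨Ω, _, P, _, X, hX, h0, hm⟩ := exists_iid f hf
  have hE : 0 ≤ 𝔼 w, ‖f w‖ ^ 2 := expect_nonneg fun _ _ => by positivity
  -- The factor 2 turns the bound on the upper limit into a strict one, provided the second moment
  -- is positive; otherwise `f` vanishes.
  rcases hE.eq_or_lt with hE | hE
  · have h1 : ∀ w, f w = 0 := fun w => by
      have h2 := (expect_eq_zero_iff_of_nonneg fun w _ => by positivity).1 hE.symm w (mem_univ w)
      simpa using h2
    exact .of_forall fun m => by simp [h1]
  · have h1 := hB Ω P X hX
    rw [h0] at h1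
    have h2 : (c : ℝ≥0∞) * ENNReal.ofReal (𝔼 w, ‖f w‖ ^ 2)
        < ENNReal.ofReal (2 * c * 𝔼 w, ‖f w‖ ^ 2) := by
      rw [← ENNReal.ofReal_coe_nnreal, ← ENNReal.ofReal_mul c.coe_nonneg, ENNReal.ofReal_lt_ofReal_iff]
      · have : (0 : ℝ) < c * 𝔼 w, ‖f w‖ ^ 2 := mul_pos (by exact_mod_cast hc) hE
        linarith
      · have : (0 : ℝ) < c := by exact_mod_cast hc
        positivity
    filter_upwards [eventually_lt_of_limsup_lt (h1.trans_lt h2), eventually_gt_atTop 0]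
      with m hm1 hm0
    have hm0' : (0 : ℝ) < m := by exact_mod_cast hm0
    rw [hm, ← ENNReal.ofReal_natCast, ← ENNReal.ofReal_div_of_pos hm0'] at hm1
    have h3 := (ENNReal.ofReal_lt_ofReal_iff_of_nonneg
      (div_nonneg (expect_nonneg fun _ _ => by positivity) hm0'.le)).1 hm1
    rw [div_lt_iff₀ hm0'] at h3
    linarith

lemma LiminfWith.eventually_le [BorelSpace B] [CompleteSpace B]
    [SecondCountableTopology B] {c : ℝ≥0} (hc : 0 < c)
    (hB : LiminfWith.{u, v} B c) {W : Type v} [Fintype W] [Nonempty W] (f : W → B)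
    (hf : ∑ w, f w = 0) :
    ∀ᶠ m : ℕ in atTop, c / 2 * m * 𝔼 w, ‖f w‖ ^ 2 ≤ 𝔼 ω : Fin m → W, ‖∑ u, f (ω u)‖ ^ 2 := by
  obtain ⟨Ω, _, P, _, X, hX, h0, hm⟩ := exists_iid f hf
  have hE : 0 ≤ 𝔼 w, ‖f w‖ ^ 2 := expect_nonneg fun _ _ => by positivity
  rcases hE.eq_or_lt with hE | hE
  · refine .of_forall fun m => ?_
    rw [← hE, mul_zero]
    exact expect_nonneg fun _ _ => by positivity
  · have h1 := hB Ω P X hX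
    rw [h0] at h1
    have hc' : (0 : ℝ) < c := by exact_mod_cast hc
    have h2 : ENNReal.ofReal (c / 2 * 𝔼 w, ‖f w‖ ^ 2)
        < (c : ℝ≥0∞) * ENNReal.ofReal (𝔼 w, ‖f w‖ ^ 2) := by
      rw [← ENNReal.ofReal_coe_nnreal, ← ENNReal.ofReal_mul c.coe_nonneg, ENNReal.ofReal_lt_ofReal_iff]
      · nlinarith
      · positivity
    filter_upwards [eventually_lt_of_lt_liminf (h2.trans_le h1), eventually_gt_atTop 0]
      with m hm1 hm0
    have hm0' : (0 : ℝ) < m := by exact_mod_cast hm0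
    rw [hm, ← ENNReal.ofReal_natCast, ← ENNReal.ofReal_div_of_pos hm0'] at hm1
    have h3 := (ENNReal.ofReal_lt_ofReal_iff_of_nonneg (by positivity)).1 hm1
    rw [lt_div_iff₀ hm0'] at h3
    linarith

lemma eventually_one_le_mul {p : ℝ} (hp : 0 < p) : ∀ᶠ m : ℕ in atTop, 1 ≤ m * p :=
  (tendsto_natCast_atTop_atTop.atTop_mul_const hp).eventually_ge_atTop 1

lemma LimsupWith.weakTypeTwoWith [BorelSpace B] [CompleteSpace B]
    [SecondCountableTopology B] {c : ℝ≥0}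
    (hc : 0 < c) (hB : LimsupWith.{u, v} B c) : WeakTypeTwoWith.{u, v} B (3 * c) := by
  intro k y
  obtain ⟨S, _, _, a, p, hp, hkp, ha⟩ := IsSymmetricStep.exists_step.{v} k
  obtain ⟨m, hm, hmp⟩ := ((hB.eventually_le hc (fun w : Fin k → S => ∑ i, a (w i) • y i)
    (ha.expect_sum_smul_eq_zero y)).and (eventually_one_le_mul hp)).exists
  refine ⟨Fin m → S, inferInstance, inferInstance, _, ha.isSymmetricStandardized hmp, ?_⟩
  rw [expect_norm_walk_sq a hmp] at hm
  have h1 := ha.expect_norm_sq_le (by simpa using hkp) y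
  have hm0 : 0 < m * p := by linarith
  refine le_of_mul_le_mul_left (hm.trans ?_) hm0
  calc _ ≤ 2 * c * m * (3 / 2 * p * ∑ i, ‖y i‖ ^ 2) := by gcongr
    _ = _ := by ring

lemma LiminfWith.weakCotypeTwoWith [BorelSpace B] [CompleteSpace B]
    [SecondCountableTopology B] {c : ℝ≥0}
    (hc : 0 < c) (hB : LiminfWith.{u, v} B c) : WeakCotypeTwoWith.{u, v} B (c / 4) := by
  intro k β _ y
  obtain ⟨S, _, _, a, p, hp, hkp, ha⟩ := IsSymmetricStep.exists_step.{v} k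
  -- Finitely many eventual conditions hold at a common m, so a single h serves all families.
  obtain ⟨m, hm, hmp⟩ := ((eventually_all.2 fun b =>
    hB.eventually_le hc (fun w : Fin k → S => ∑ i, a (w i) • y b i)
      (ha.expect_sum_smul_eq_zero (y b))).and (eventually_one_le_mul hp)).exists
  refine ⟨Fin m → S, inferInstance, inferInstance, _, ha.isSymmetricStandardized hmp,
    fun b => ?_⟩
  have hmb := hm b
  rw [expect_norm_walk_sq a hmp] at hmb
  have h1 := ha.le_expect_norm_sq (by simpa using hkp) (y b)
  have hm0 : 0 < m * p := by linarith
  refine le_of_mul_le_mul_left (le_trans ?_ hmb) hm0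
  calc _ = c / 2 * m * (1 / 2 * p * ∑ i, ‖y b i‖ ^ 2) := by ring
    _ ≤ _ := by gcongr

end IID

/-! ### Symmetrization of independent centred variables -/

section Independent

variable {B : Type u} [NormedAddCommGroup B] [NormedSpace ℝ B] [MeasurableSpace B]
  {Ω : Type v} [MeasurableSpace Ω] {P : Measure Ω}

lemma MemL2Zero.integrable [IsProbabilityMeasure P] {X : Ω → B} (hX : MemL2Zero P X) :
    Integrable X P := hX.memLp.integrable one_le_two

lemma MemL2Zero.sign [BorelSpace B] {X : Ω → B} (hX : MemL2Zero P X) (s : ℤˣ) :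
    MemL2Zero P fun ω => s • X ω := by
  rcases Int.units_eq_one_or s with rfl | rfl
  · simpa using hX
  · have h : (fun ω => (-1 : ℤˣ) • X ω) = -X := by ext; simp [Units.smul_def]
    rw [h]
    exact ⟨hX.measurable.neg, hX.memLp.neg, by simp [integral_neg, hX.mean_zero]⟩

lemma enorm_integral_sq_le_lintegral {μ : Measure Ω} [IsProbabilityMeasure μ] {g : Ω → B}
    (hg : AEStronglyMeasurable g μ) : ‖∫ v, g v ∂μ‖ₑ ^ 2 ≤ ∫⁻ v, ‖g v‖ₑ ^ 2 ∂μ := by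
  have h1 := (enorm_integral_le_lintegral_enorm (μ := μ) g).trans
    (eLpNorm_one_eq_lintegral_enorm.symm.le.trans
      (eLpNorm_le_eLpNorm_of_exponent_le (p := 1) (q := 2) one_le_two hg))
  rw [eLpNorm_eq_lintegral_rpow_enorm_toReal two_ne_zero ENNReal.ofNat_ne_top] at h1
  have h2 := pow_le_pow_left' h1 2
  rw [← ENNReal.rpow_natCast (_ ^ _), ← ENNReal.rpow_mul] at h2
  simpa using h2

/-- Adding an independent centred random variable does not decrease the second moment. -/
lemma secondMoment_le_secondMoment_add [BorelSpace B] [SecondCountableTopology B]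
    [CompleteSpace B] [IsProbabilityMeasure P] {U V : Ω → B} (hU : Measurable U)
    (hV : Measurable V) (hVi : Integrable V P) (hV0 : ∫ ω, V ω ∂P = 0) (hUV : IndepFun U V P) :
    secondMoment P U ≤ secondMoment P fun ω => U ω + V ω := by
  have hμ := (indepFun_iff_map_prod_eq_prod_map_map hU.aemeasurable hV.aemeasurable).1 hUV
  have : IsProbabilityMeasure (P.map V) := Measure.isProbabilityMeasure_map hV.aemeasurable
  have hid : Integrable (fun v : B => v) (P.map V) :=
    (integrable_map_measure aestronglyMeasurable_id hV.aemeasurable).2 hVi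
  have hid0 : ∫ v, v ∂P.map V = 0 := by
    exact (integral_map hV.aemeasurable aestronglyMeasurable_id).trans hV0
  have h1 : secondMoment P (fun ω => U ω + V ω)
      = ∫⁻ x, ∫⁻ v, ‖x + v‖ₑ ^ 2 ∂P.map V ∂P.map U := by
    have h2 := lintegral_map (μ := P) (f := fun z : B × B => ‖z.1 + z.2‖ₑ ^ 2)
      (g := fun ω => (U ω, V ω)) (by fun_prop) (by fun_prop)
    rw [hμ, lintegral_prod _ (by fun_prop)] at h2
    exact h2.symm
  have h3 : secondMoment P U = ∫⁻ x, ‖x‖ₑ ^ 2 ∂P.map U :=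
    (lintegral_map (f := fun x : B => ‖x‖ₑ ^ 2) (by fun_prop) hU).symm
  rw [h1, h3]
  refine lintegral_mono fun x => ?_
  have h4 : ∫ v, (x + v) ∂P.map V = x := by
    rw [integral_add (integrable_const _) hid, hid0, add_zero, integral_const]
    simp
  calc ‖x‖ₑ ^ 2 = ‖∫ v, (x + v) ∂P.map V‖ₑ ^ 2 := by rw [h4]
    _ ≤ _ := enorm_integral_sq_le_lintegral (by fun_prop)

lemma enorm_sq_eq_ofReal (x : B) : ‖x‖ₑ ^ 2 = ENNReal.ofReal (‖x‖ ^ 2) := by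
  rw [ENNReal.ofReal_pow (norm_nonneg _), ofReal_norm]

lemma enorm_add_sq_le (x y : B) : ‖x + y‖ₑ ^ 2 ≤ 2 * ‖x‖ₑ ^ 2 + 2 * ‖y‖ₑ ^ 2 := by
  simp_rw [enorm_sq_eq_ofReal]
  rw [show (2 : ℝ≥0∞) = ENNReal.ofReal 2 by simp, ← ENNReal.ofReal_mul zero_le_two,
    ← ENNReal.ofReal_mul zero_le_two, ← ENNReal.ofReal_add (by positivity) (by positivity)]
  exact ENNReal.ofReal_le_ofReal (norm_add_sq_le x y)

/-- Let U and V be the sums over the indices with sign +1 and -1. Each is independent of the other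
and centred, so both second moments are at most that of U - V, while ‖U + V‖² ≤ 2‖U‖² + 2‖V‖². -/
lemma secondMoment_sum_le_sign [BorelSpace B] [SecondCountableTopology B] [CompleteSpace B]
    [IsProbabilityMeasure P] {n : ℕ} {X : Fin n → Ω → B} (hind : iIndepFun X P)
    (hX : ∀ i, MemL2Zero P (X i)) (s : Fin n → ℤˣ) :
    secondMoment P (fun ω => ∑ i, X i ω) ≤ 4 * secondMoment P fun ω => ∑ i, s i • X i ω := by
  set A : Finset (Fin n) := {i | s i = 1} with hA
  set U : Ω → B := fun ω => ∑ i ∈ A, X i ω with hUdef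
  set V : Ω → B := fun ω => ∑ i ∈ Aᶜ, X i ω with hVdef
  have hm : ∀ i, Measurable (X i) := fun i => (hX i).measurable
  have hUm : Measurable U := by fun_prop
  have hVm : Measurable V := by fun_prop
  have hUi : Integrable U P := integrable_finsetSum _ fun i _ => (hX i).integrable
  have hVi : Integrable V P := integrable_finsetSum _ fun i _ => (hX i).integrable
  have hU0 : ∫ ω, U ω ∂P = 0 := by
    rw [integral_finsetSum _ fun i _ => (hX i).integrable]
    exact sum_eq_zero fun i _ => (hX i).mean_zero
  have hV0 : ∫ ω, V ω ∂P = 0 := by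
    rw [integral_finsetSum _ fun i _ => (hX i).integrable]
    exact sum_eq_zero fun i _ => (hX i).mean_zero
  have hUV : IndepFun U V P := by
    have h := (hind.indepFun_finset A Aᶜ disjoint_compl_right hm).comp
      (φ := fun x : A → B => ∑ i, x i) (ψ := fun x : (Aᶜ : Finset (Fin n)) → B => ∑ i, x i)
      (by fun_prop) (by fun_prop)
    convert h using 1 <;> ext ω <;> simp only [Function.comp_apply, hUdef, hVdef]
    · exact (sum_coe_sort A fun i => X i ω).symm
    · exact (sum_coe_sort Aᶜ fun i => X i ω).symm
  have hS : ∀ ω, ∑ i, X i ω = U ω + V ω := fun ω => (sum_add_sum_compl A _).symm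
  have hT : ∀ ω, ∑ i, s i • X i ω = U ω + -V ω := by
    intro ω
    rw [← sum_add_sum_compl A, hUdef, hVdef]
    simp only [← sum_neg_distrib]
    congr 1
    · exact sum_congr rfl fun i hi => by simp [(mem_filter.1 hi).2]
    · refine sum_congr rfl fun i hi => ?_
      have h : s i = -1 := (Int.units_eq_one_or (s i)).resolve_left fun h => by
        simp [hA, h] at hi
      simp [h, Units.smul_def]
  simp_rw [hS, hT]
  have h1 : secondMoment P U ≤ secondMoment P fun ω => U ω + -V ω :=
    secondMoment_le_secondMoment_add hUm hVm.neg hVi.neg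
      (by simp [integral_neg, hV0]) (hUV.comp measurable_id measurable_neg)
  have h2 : secondMoment P V ≤ secondMoment P fun ω => U ω + -V ω := by
    have h3 := secondMoment_le_secondMoment_add hVm hUm.neg hUi.neg
      (by simp [integral_neg, hU0]) (hUV.symm.comp measurable_id measurable_neg)
    refine h3.trans (le_of_eq ?_)
    simp only [secondMoment]
    refine lintegral_congr fun ω => ?_
    rw [← enorm_neg]
    simp
  calc secondMoment P (fun ω => U ω + V ω)
      ≤ ∫⁻ ω, (2 * ‖U ω‖ₑ ^ 2 + 2 * ‖V ω‖ₑ ^ 2) ∂P := lintegral_mono fun ω => enorm_add_sq_le _ _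
    _ = 2 * secondMoment P U + 2 * secondMoment P V := by
      rw [lintegral_add_left (by fun_prop), lintegral_const_mul _ (by fun_prop),
        lintegral_const_mul _ (by fun_prop)]
      rfl
    _ ≤ 2 * secondMoment P (fun ω => U ω + -V ω) + 2 * secondMoment P (fun ω => U ω + -V ω) := by
      gcongr
    _ = _ := by rw [← add_mul]; norm_num

lemma secondMoment_sign_sum_le [BorelSpace B] [SecondCountableTopology B] [CompleteSpace B]
    [IsProbabilityMeasure P] {n : ℕ} {X : Fin n → Ω → B} (hind : iIndepFun X P)
    (hX : ∀ i, MemL2Zero P (X i)) (s : Fin n → ℤˣ) :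
    secondMoment P (fun ω => ∑ i, s i • X i ω) ≤ 4 * secondMoment P fun ω => ∑ i, X i ω := by
  have hind' : iIndepFun (fun i ω => s i • X i ω) P :=
    hind.comp (fun i x => s i • x) fun i => by
      rcases Int.units_eq_one_or (s i) with h | h
      · simpa [h] using measurable_id'
      · simpa [h, Units.smul_def] using measurable_neg
  refine (secondMoment_sum_le_sign hind' (fun i => (hX i).sign (s i)) s).trans (le_of_eq ?_)
  simp [smul_smul, Int.units_mul_self]

lemma card_mul_lintegral_rademacherAvg [BorelSpace B] [SecondCountableTopology B] {n : ℕ}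
    {X : Fin n → Ω → B} (hX : ∀ i, Measurable (X i)) :
    (Fintype.card (Fin n → ℤˣ) : ℝ≥0∞) * ∫⁻ ω, ENNReal.ofReal (rademacherAvg fun i => X i ω) ∂P
      = ∑ s : Fin n → ℤˣ, secondMoment P fun ω => ∑ i, s i • X i ω := by
  have hm : ∀ s : Fin n → ℤˣ, Measurable fun ω => ∑ i, s i • X i ω := fun s =>
    Finset.measurable_sum _ fun i _ => by
      rcases Int.units_eq_one_or (s i) with h | h
      · simpa [h] using hX i
      · have h2 : (fun ω => s i • X i ω) = -X i := by ext; simp [h, Units.smul_def]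
        exact h2 ▸ (hX i).neg
  simp only [secondMoment]
  rw [← lintegral_const_mul' _ _ (ENNReal.natCast_ne_top _),
    ← lintegral_finsetSum _ fun s _ => (hm s).enorm.pow_const 2]
  refine lintegral_congr fun ω => ?_
  simp_rw [enorm_sq_eq_ofReal]
  rw [← ENNReal.ofReal_sum_of_nonneg fun _ _ => by positivity, ← ENNReal.ofReal_natCast,
    ← ENNReal.ofReal_mul (by positivity), rademacherAvg, Fintype.card_mul_expect]

lemma secondMoment_sum_le_lintegral_rademacherAvg [BorelSpace B] [SecondCountableTopology B]
    [CompleteSpace B] [IsProbabilityMeasure P] {n : ℕ} {X : Fin n → Ω → B}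
    (hind : iIndepFun X P) (hX : ∀ i, MemL2Zero P (X i)) :
    secondMoment P (fun ω => ∑ i, X i ω)
      ≤ 4 * ∫⁻ ω, ENNReal.ofReal (rademacherAvg fun i => X i ω) ∂P := by
  have h0 : (Fintype.card (Fin n → ℤˣ) : ℝ≥0∞) ≠ 0 := by
    exact_mod_cast Fintype.card_ne_zero
  rw [← ENNReal.mul_le_mul_iff_right h0 (ENNReal.natCast_ne_top _), mul_left_comm,
    card_mul_lintegral_rademacherAvg fun i => (hX i).measurable, mul_sum, ← nsmul_eq_mul,
    ← card_univ]
  exact card_nsmul_le_sum _ _ _ fun s _ => secondMoment_sum_le_sign hind hX s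

lemma lintegral_rademacherAvg_le_secondMoment_sum [BorelSpace B] [SecondCountableTopology B]
    [CompleteSpace B] [IsProbabilityMeasure P] {n : ℕ} {X : Fin n → Ω → B}
    (hind : iIndepFun X P) (hX : ∀ i, MemL2Zero P (X i)) :
    ∫⁻ ω, ENNReal.ofReal (rademacherAvg fun i => X i ω) ∂P
      ≤ 4 * secondMoment P fun ω => ∑ i, X i ω := by
  have h0 : (Fintype.card (Fin n → ℤˣ) : ℝ≥0∞) ≠ 0 := by
    exact_mod_cast Fintype.card_ne_zero
  rw [← ENNReal.mul_le_mul_iff_right h0 (ENNReal.natCast_ne_top _),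
    card_mul_lintegral_rademacherAvg fun i => (hX i).measurable, ← nsmul_eq_mul, ← card_univ]
  exact sum_le_card_nsmul _ _ _ fun s _ => secondMoment_sign_sum_le hind hX s

lemma lintegral_ofReal_mul_sum_norm_sq [BorelSpace B] {n : ℕ} {X : Fin n → Ω → B}
    (hX : ∀ i, Measurable (X i)) (c : ℝ≥0) :
    ∫⁻ ω, ENNReal.ofReal (c * ∑ i, ‖X i ω‖ ^ 2) ∂P = c * ∑ i, secondMoment P (X i) := by
  simp only [secondMoment]
  rw [← lintegral_finsetSum _ fun i _ => (hX i).enorm.pow_const 2,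
    ← lintegral_const_mul' _ _ ENNReal.coe_ne_top]
  refine lintegral_congr fun ω => ?_
  rw [ENNReal.ofReal_mul c.coe_nonneg, ENNReal.ofReal_sum_of_nonneg fun _ _ => by positivity]
  simp only [enorm_sq_eq_ofReal, ENNReal.ofReal_coe_nnreal]

end Independent

/-! ### The equivalences and their constants -/

section Equivalence

variable {B : Type u} [NormedAddCommGroup B] [NormedSpace ℝ B] [MeasurableSpace B]

lemma CotypeTwoWith.mono {c c' : ℝ≥0} (h : c' ≤ c) (hB : CotypeTwoWith.{u, v} B c) :
    CotypeTwoWith.{u, v} B c' := fun Ω _ P _ n X hn hi hX =>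
  le_trans (by gcongr) (hB Ω P n X hn hi hX)

lemma secondMoment_partialSum {Ω : Type v} [MeasurableSpace Ω] (P : Measure Ω) (X : ℕ → Ω → B)
    (n : ℕ) : secondMoment P (partialSum X n) = secondMoment P fun ω => ∑ i : Fin n, X i ω := by
  congr 1
  ext ω
  exact Finset.sum_range _

lemma IsIIDL2Zero.secondMoment_eq [BorelSpace B] {Ω : Type v} [MeasurableSpace Ω] {P : Measure Ω}
    {X : ℕ → Ω → B} (hX : IsIIDL2Zero P X) (i : ℕ) :
    secondMoment P (X i) = secondMoment P (X 0) :=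
  ((hX.identDistrib i).comp (u := fun x : B => ‖x‖ₑ ^ 2) (by fun_prop)).lintegral_eq

lemma TypeTwoWith.limsupWith [BorelSpace B] {c : ℝ≥0} (hB : TypeTwoWith.{u, v} B c) :
    LimsupWith.{u, v} B c := by
  intro Ω _ P _ X hX
  refine limsup_le_of_le (h := ?_)
  filter_upwards [eventually_ge_atTop 1] with n hn
  rw [secondMoment_partialSum]
  refine ENNReal.div_le_of_le_mul ((hB Ω P n (fun i => X i) hn
    (hX.indep.precomp Fin.val_injective) fun i => hX.memL2Zero i).trans (le_of_eq ?_))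
  simp_rw [hX.secondMoment_eq]
  simp [mul_left_comm, mul_comm]

lemma CotypeTwoWith.liminfWith [BorelSpace B] {c : ℝ≥0} (hB : CotypeTwoWith.{u, v} B c) :
    LiminfWith.{u, v} B c := by
  intro Ω _ P _ X hX
  refine le_liminf_of_le (h := ?_)
  filter_upwards [eventually_ge_atTop 1] with n hn
  rw [secondMoment_partialSum, ENNReal.le_div_iff_mul_le (by simp; omega) (by simp)]
  refine le_trans (le_of_eq ?_) (hB Ω P n (fun i => X i) hn
    (hX.indep.precomp Fin.val_injective) fun i => hX.memL2Zero i)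
  simp_rw [hX.secondMoment_eq]
  simp [mul_left_comm, mul_comm]

lemma LimsupWith.mono {c c' : ℝ≥0} (h : c ≤ c') (hB : LimsupWith.{u, v} B c) :
    LimsupWith.{u, v} B c' := fun Ω _ P _ X hX => (hB Ω P X hX).trans (by gcongr)

lemma LiminfWith.mono {c c' : ℝ≥0} (h : c' ≤ c) (hB : LiminfWith.{u, v} B c) :
    LiminfWith.{u, v} B c' := fun Ω _ P _ X hX => le_trans (by gcongr) (hB Ω P X hX)

variable [BorelSpace B] [SecondCountableTopology B] [CompleteSpace B]

/-- 48 = 4 · 4 · 3: symmetrization, passage from h to signs, and the weak type constant. -/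
lemma LimsupWith.typeTwoWith {c : ℝ≥0} (hc : 0 < c) (hB : LimsupWith.{u, v} B c) :
    TypeTwoWith.{u, v} B (48 * c) := by
  intro Ω _ P _ n X _ hind hX
  have hR : ∀ x : Fin n → B, rademacherAvg x ≤ (12 * c : ℝ≥0) * ∑ i, ‖x i‖ ^ 2 := by
    intro x
    obtain ⟨Q, _, _, h, hh, hle⟩ := hB.weakTypeTwoWith hc n x
    refine (hh.rademacherAvg_le x).trans ?_
    push_cast
    linarith
  calc secondMoment P (fun ω => ∑ i, X i ω)
      ≤ 4 * ∫⁻ ω, ENNReal.ofReal (rademacherAvg fun i => X i ω) ∂P :=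
        secondMoment_sum_le_lintegral_rademacherAvg hind hX
    _ ≤ 4 * ∫⁻ ω, ENNReal.ofReal ((12 * c : ℝ≥0) * ∑ i, ‖X i ω‖ ^ 2) ∂P := by
        gcongr with ω
        exact hR _
    _ = _ := by
        rw [lintegral_ofReal_mul_sum_norm_sq fun i => (hX i).measurable, ← mul_assoc]
        congr 1
        push_cast
        rw [← mul_assoc]
        norm_num

/-- The weak constant c/4 yields (c/4)² / 256 for signs, and symmetrization costs another factor 4.
-/
lemma LiminfWith.cotypeTwoWith {c : ℝ≥0} (hc : 0 < c) (hB : LiminfWith.{u, v} B c) :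
    CotypeTwoWith.{u, v} B (c ^ 2 / 16384) := by
  intro Ω _ P _ n X _ hind hX
  have hR : ∀ x : Fin n → B, (c ^ 2 / 4096 : ℝ≥0) * ∑ i, ‖x i‖ ^ 2 ≤ rademacherAvg x := by
    intro x
    refine le_of_eq_of_le ?_ ((hB.weakCotypeTwoWith hc).le_rademacherAvg
      (by have : (0 : ℝ) < c := by exact_mod_cast hc
          positivity) x)
    push_cast
    ring
  have h1 : ((c ^ 2 / 4096 : ℝ≥0) : ℝ≥0∞) * ∑ i, secondMoment P (X i)
      ≤ 4 * secondMoment P fun ω => ∑ i, X i ω := by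
    rw [← lintegral_ofReal_mul_sum_norm_sq fun i => (hX i).measurable]
    refine (lintegral_mono fun ω => ?_).trans (lintegral_rademacherAvg_le_secondMoment_sum hind hX)
    exact ENNReal.ofReal_le_ofReal (hR _)
  have h2 : (c ^ 2 / 4096 : ℝ≥0) = 4 * (c ^ 2 / 16384) := by
    ext; push_cast; ring
  rw [h2, ENNReal.coe_mul, mul_assoc] at h1
  exact (ENNReal.mul_le_mul_iff_right (by simp) (by simp)).1 h1

end Equivalence

end BanachType

theorem proposition2p1 :
    -- the two characterizations, for every separable Banach space
    (∀ (B : Type u) [NormedAddCommGroup B] [NormedSpace ℝ B] [CompleteSpace B]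
        [TopologicalSpace.SeparableSpace B] [MeasurableSpace B] [BorelSpace B],
      (BanachType.IsTypeTwo.{u, v} B ↔ ∃ c : ℝ≥0, 0 < c ∧ BanachType.LimsupWith.{u, v} B c) ∧
      (BanachType.IsCotypeTwo.{u, v} B ↔ ∃ c : ℝ≥0, 0 < c ∧ BanachType.LiminfWith.{u, v} B c)) ∧
    -- type 2: each constant may be chosen to depend only on the other, not on the space
    (∀ c : ℝ≥0, 0 < c → ∃ c' : ℝ≥0, 0 < c' ∧
      ∀ (B : Type u) [NormedAddCommGroup B] [NormedSpace ℝ B] [CompleteSpace B]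
        [TopologicalSpace.SeparableSpace B] [MeasurableSpace B] [BorelSpace B],
        (BanachType.LimsupWith.{u, v} B c → BanachType.TypeTwoWith.{u, v} B c') ∧
        (BanachType.TypeTwoWith.{u, v} B c → BanachType.LimsupWith.{u, v} B c')) ∧
    -- cotype 2: each constant may be chosen to depend only on the other, not on the space
    (∀ c : ℝ≥0, 0 < c → ∃ c' : ℝ≥0, 0 < c' ∧
      ∀ (B : Type u) [NormedAddCommGroup B] [NormedSpace ℝ B] [CompleteSpace B]
        [TopologicalSpace.SeparableSpace B] [MeasurableSpace B] [BorelSpace B],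
        (BanachType.LiminfWith.{u, v} B c → BanachType.CotypeTwoWith.{u, v} B c') ∧
        (BanachType.CotypeTwoWith.{u, v} B c → BanachType.LiminfWith.{u, v} B c')) := by
  refine ⟨fun B _ _ _ _ _ _ => ?_, fun c hc => ⟨48 * c, by positivity, fun B _ _ _ _ _ _ => ?_⟩,
    -- One constant must serve both implications, hence the minimum; for type 2, 48c already exceeds
    -- c.
    fun c hc => ⟨min c (c ^ 2 / 16384), by positivity, fun B _ _ _ _ _ _ => ?_⟩⟩ <;>
  have := UniformSpace.secondCountable_of_separable B
  · exact ⟨⟨fun ⟨c, hc, h⟩ => ⟨c, hc, h.limsupWith⟩,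
        fun ⟨c, hc, h⟩ => ⟨48 * c, by positivity, h.typeTwoWith hc⟩⟩,
      ⟨fun ⟨c, hc, h⟩ => ⟨c, hc, h.liminfWith⟩,
        fun ⟨c, hc, h⟩ => ⟨c ^ 2 / 16384, by positivity, h.cotypeTwoWith hc⟩⟩⟩
  · exact ⟨fun h => h.typeTwoWith hc, fun h => h.limsupWith.mono <|
      le_mul_of_one_le_left c.2 (by norm_num)⟩
  · exact ⟨fun h => (h.cotypeTwoWith hc).mono (min_le_right _ _),
      fun h => h.liminfWith.mono (min_le_left _ _)⟩
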